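/- Let $k$ be a field, $X=\{x_1<\dots<x_n\}$ a finite non-empty set with a fixed enumeration, $f$ a permutation of $X$, and $r_f:X\times X\to X\times X$, $r_f(x,y)=(f(y),y)$, the corresponding permutation idempotent solution of the Yang--Baxter equation. For a map $r:X\times X\to X\times X$, written $r(x,y)=({}^xy,x^y)$, let $\mathcal A(k,X,r)=k\langle X\rangle/I$, where $I$ is the two-sided ideal generated by all $xy-({}^xy)(x^y)$, graded by length. Let $\mathcal N_d$ be the set of words of length $d$ that are normal modulo $I$ for the degree-lexicographic order, let $\mathrm{Nor}$ be the normal form modulo $I$, and let $\rho_d(a,b)=(\mathrm{Nor}({}^ab),\mathrm{Nor}(a^b))$ for $a,b\in\mathcal N_d$, where the two actions of letters on letters given by $r$ are extended to words by ${}^{ab}u={}^a({}^bu)$, $a^{uv}=(a^u)^v$, ${}^a(uv)=({}^au)({}^{a^u}v)$, $(ab)^u=(a^{{}^bu})(b^u)$. Then for every integer $d\ge 2$: (1) The $d$-th term of the Veronese prolongation of $(X,r_f)$ is $(X,r_{f^d})$. That is, for $r=r_f$ the map $x\mapsto x_1^{d-1}x$ is a bijection from $X$ onto $\mathcal N_d$,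 the map $\rho_d$ takes values in $\mathcal N_d\times\mathcal N_d$, and under this bijection $\rho_d$ corresponds to $r_{f^d}$. (2) There is an isomorphism of graded algebras $$\mathcal A(k,X,r_{f^d})\;\cong\;\mathcal A(k,X,r_f)^{(d)}=\bigoplus_{m\ge 0}\mathcal A(k,X,r_f)_{md},$$ where the component of degree $m$ of the $d$-Veronese subalgebra on the right is $\mathcal A(k,X,r_f)_{md}$, and this isomorphism sends each generator $x\in X$ to $x_1^{d-1}x$. -/

import Mathlib

namespace YangBaxterAlgebra

universe u v

/-! ### Words and the free associative algebra -/

section Words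

variable (k : Type u) [Field k] {X : Type v}

/-- The monomial of `k⟨X⟩` given by a word in the alphabet `X`. -/
noncomputable def word (w : List X) : FreeAlgebra k X :=
  (w.map (FreeAlgebra.ι k)).prod

/-- The coefficient of the word `w` in the noncommutative polynomial `p`. -/
noncomputable def coeff (p : FreeAlgebra k X) (w : List X) : k :=
  (FreeAlgebra.basisFreeMonoid k X).repr p (FreeMonoid.ofList w)

/-- The word `w` is the leading monomial of `p` for the degree-lexicographic order. -/
def IsLeadingMonomial [LinearOrder X] (p : FreeAlgebra k X) (w : List X) : Prop :=
  coeff k p w ≠ 0 ∧ ∀ u : List X, coeff k p u ≠ 0 → u ≠ w → List.Shortlex (· < ·) u w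

/-- The set `N(I)` of normal words modulo an ideal `I`: the words that do not contain as a subword
the leading monomial of any element of `I`. -/
def normalWords [LinearOrder X] (I : TwoSidedIdeal (FreeAlgebra k X)) : Set (List X) :=
  {w | ∀ p ∈ I, ∀ u : List X, IsLeadingMonomial k p u → ¬ u <:+: w}

/-- `q = Nor(p)`: the polynomial `q` is a linear combination of normal words modulo `I`, and it is
congruent to `p` modulo `I`. -/
def IsNormalForm [LinearOrder X] (I : TwoSidedIdeal (FreeAlgebra k X))
    (p q : FreeAlgebra k X) : Prop :=
  q ∈ Submodule.span k (word k '' normalWords k I) ∧ p - q ∈ I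

end Words

/-! ### The quadratic algebra of a quadratic set, with its grading -/

section Algebra

variable (k : Type u) [Field k] {X : Type v} (r : X × X → X × X)

/-- The defining relations `xy - y'x'`, where `r (x, y) = (y', x') ≠ (x, y)`. -/
def relations : Set (FreeAlgebra k X) :=
  {p | ∃ x y : X, r (x, y) ≠ (x, y) ∧
    p = word k [x, y] - word k [(r (x, y)).1, (r (x, y)).2]}

/-- The two-sided ideal of `k⟨X⟩` generated by the defining relations. -/
def relationIdeal : TwoSidedIdeal (FreeAlgebra k X) :=
  TwoSidedIdeal.span (relations k r)

/-- The algebra `A(k, X, r)`, the quotient of `k⟨X⟩` by the ideal of relations. -/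
abbrev YBAlgebra : Type (max u v) :=
  (relationIdeal k r).ringCon.Quotient

/-- The quotient map `k⟨X⟩ → A(k, X, r)`. -/
def mkYB : FreeAlgebra k X →ₐ[k] YBAlgebra k r :=
  (relationIdeal k r).ringCon.mkₐ k

/-- The component of `A(k, X, r)` of degree `m`, spanned by the images of the words of
length `m`. -/
def component (m : ℕ) : Submodule k (YBAlgebra k r) :=
  Submodule.span k ((fun w => mkYB k r (word k w)) '' {w : List X | w.length = m})

instance componentGradedMonoid : SetLike.GradedMonoid (component k r) where
  one_mem := Submodule.subset_span ⟨[], rfl, by simp [word]⟩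
  mul_mem := by
    intro i j a b ha hb
    have h : a * b ∈ component k r i * component k r j := Submodule.mul_mem_mul ha hb
    rw [component, component, Submodule.span_mul_span] at h
    refine Submodule.span_mono ?_ h
    rintro _ ⟨_, ⟨w, hw, rfl⟩, _, ⟨w', hw', rfl⟩, rfl⟩
    refine ⟨w ++ w', ?_, by simp [word]⟩
    change (w ++ w').length = i + j
    rw [List.length_append, hw, hw']

theorem mkYB_word_mem (w : List X) : mkYB k r (word k w) ∈ component k r w.length :=
  Submodule.subset_span ⟨w, rfl, rfl⟩

open DirectSum in
/-- Auxiliary map on the free algebra that splits a polynomial into its homogeneous components. -/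
noncomputable def decomposeFree : FreeAlgebra k X →ₐ[k] ⨁ m, component k r m :=
  FreeAlgebra.lift k fun x =>
    DirectSum.of (fun m => component k r m) 1 ⟨mkYB k r (word k [x]), mkYB_word_mem k r [x]⟩

theorem decomposeFree_word (w : List X) : decomposeFree k r (word k w) =
    DirectSum.of (fun m => component k r m) w.length
      ⟨mkYB k r (word k w), mkYB_word_mem k r w⟩ := by
  induction w with
  | nil =>
    have h : word k ([] : List X) = 1 := rfl
    refine (congrArg (decomposeFree k r) h).trans ?_
    rw [map_one, DirectSum.one_def]
    exact DirectSum.of_eq_of_gradedMonoid_eq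
      (Sigma.subtype_ext rfl (map_one (mkYB k r)).symm)
  | cons x w ih =>
    have h : word k (x :: w) = FreeAlgebra.ι k x * word k w := by simp [word]
    have h1 : word k [x] = FreeAlgebra.ι k x := by simp [word]
    refine (congrArg (decomposeFree k r) h).trans ?_
    rw [map_mul, ih, decomposeFree, FreeAlgebra.lift_ι_apply, DirectSum.of_mul_of]
    refine DirectSum.of_eq_of_gradedMonoid_eq (Sigma.subtype_ext ?_ ?_)
    · exact Nat.add_comm 1 w.length
    · change mkYB k r (word k [x]) * mkYB k r (word k w) = mkYB k r (word k (x :: w))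
      rw [h, h1, map_mul]

theorem decomposeFree_ker :
    (relationIdeal k r).ringCon ≤ RingCon.ker (decomposeFree k r).toRingHom := by
  have h : relationIdeal k r ≤ TwoSidedIdeal.ker (decomposeFree k r).toRingHom := by
    refine TwoSidedIdeal.span_le.2 ?_
    rintro _ ⟨x, y, hxy, rfl⟩
    have hrel : mkYB k r (word k [x, y]) =
        mkYB k r (word k [(r (x, y)).1, (r (x, y)).2]) := by
      refine (RingCon.eq _).2 ((TwoSidedIdeal.rel_iff _ _ _).2 ?_)
      exact TwoSidedIdeal.subset_span ⟨x, y, hxy, rfl⟩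
    refine (TwoSidedIdeal.mem_ker _).2 ?_
    change decomposeFree k r _ = 0
    rw [map_sub, decomposeFree_word, decomposeFree_word, sub_eq_zero]
    exact DirectSum.of_eq_of_gradedMonoid_eq (Sigma.subtype_ext rfl hrel)
  intro p q hpq
  have hm := h ((TwoSidedIdeal.rel_iff _ _ _).1 hpq)
  rw [TwoSidedIdeal.mem_ker, map_sub, sub_eq_zero] at hm
  exact hm

/-- `A(k, X, r)` is graded by length. -/
noncomputable instance componentGradedAlgebra : GradedAlgebra (component k r) :=
  GradedAlgebra.ofAlgHom (component k r)
    (RingCon.liftₐ _ (decomposeFree k r) (decomposeFree_ker k r))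
    (by
      ext x
      change DirectSum.coeAlgHom (component k r) (decomposeFree k r (FreeAlgebra.ι k x)) =
        mkYB k r (FreeAlgebra.ι k x)
      rw [decomposeFree, FreeAlgebra.lift_ι_apply, DirectSum.coeAlgHom_of]
      simp [word])
    (by
      rintro m ⟨a, ha⟩
      induction ha using Submodule.span_induction with
      | mem a h =>
        obtain ⟨w, hw, rfl⟩ := h
        change w.length = m at hw
        subst hw
        exact decomposeFree_word k r w
      | zero => exact (map_zero _).trans (map_zero _).symm
      | add a b ha hb iha ihb =>
        refine (map_add _ a b).trans ?_
        rw [iha, ihb, ← map_add]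
        rfl
      | smul c a ha ih =>
        refine (map_smul _ c a).trans ?_
        rw [ih]
        exact ((DirectSum.lof k ℕ (fun m => component k r m) m).map_smul c ⟨a, ha⟩).symm)

end Algebra

/-! ### Veronese subalgebras -/

section Veronese

variable {k : Type u} [Field k] {A : Type v} [Ring A] [Algebra k A]

/-- The `d`-Veronese subalgebra `⨁ₘ A_{md}` of a graded algebra `A = ⨁ₘ A_m`. -/
def veronese (𝒜 : ℕ → Submodule k A) [GradedAlgebra 𝒜] (d : ℕ) : Subalgebra k A :=
  (⨆ m : ℕ, 𝒜 (m * d)).toSubalgebra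
    (Submodule.mem_iSup_of_mem 0 (by simpa using SetLike.GradedOne.one_mem (A := 𝒜)))
    (by
      intro a b ha hb
      have h : a * b ∈ (⨆ m : ℕ, 𝒜 (m * d)) * (⨆ m : ℕ, 𝒜 (m * d)) :=
        Submodule.mul_mem_mul ha hb
      refine (?_ : _ ≤ ⨆ m : ℕ, 𝒜 (m * d)) h
      rw [Submodule.iSup_mul]
      refine iSup_le fun i => ?_
      rw [Submodule.mul_iSup]
      refine iSup_le fun j => Submodule.mul_le.2 fun x hx y hy => ?_
      refine Submodule.mem_iSup_of_mem (i + j) ?_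
      rw [add_mul]
      exact SetLike.GradedMul.mul_mem hx hy)

/-- The component of degree `m` of the `d`-Veronese subalgebra, that is `A_{md}`. -/
def veroneseComponent (𝒜 : ℕ → Submodule k A) [GradedAlgebra 𝒜] (d m : ℕ) :
    Submodule k (veronese 𝒜 d) :=
  (𝒜 (m * d)).comap (veronese 𝒜 d).val.toLinearMap

end Veronese

/-! ### The actions on words and the Veronese prolongation -/

section Prolongation

variable {X : Type v} (r : X × X → X × X)

/-- The left action of a letter on a word, where `r (c, b) = (ᶜb, cᵇ)`:
`ᶜ(b₁ b₂ ⋯ b_q) = (ᶜb₁) (ᶜ'b₂) ⋯` with `c' = cᵇ¹`, and so on. -/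
def letterActWord : X → List X → List X
  | _, [] => []
  | c, b :: bs => (r (c, b)).1 :: letterActWord (r (c, b)).2 bs

/-- The left action of words on words: `ᵃ¹⋯ᵃᵖ b = ᵃ¹(ᵃ²⋯ᵃᵖ b)`. -/
def leftAct : List X → List X → List X
  | [], b => b
  | a :: as, b => letterActWord r a (leftAct as b)

/-- The right action of a letter on a word:
`(a₁ ⋯ a_{p-1} a_p)ᶜ = ⋯ (a_{p-1})ᶜ' (a_p)ᶜ` with `c' = ᵃᵖc`, and so on. The auxiliary first
entry of the pair is the letter `ᵃ¹⋯ᵃᵖ c` that comes out on the left. -/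
def wordActLetter : List X → X → X × List X
  | [], c => (c, [])
  | a :: as, c =>
    ((r (a, (wordActLetter as c).1)).1,
      (r (a, (wordActLetter as c).1)).2 :: (wordActLetter as c).2)

/-- The right action of words on words: `a^(b₁ ⋯ b_q) = (⋯(a^b₁)^⋯)^b_q`. -/
def rightAct : List X → List X → List X
  | a, [] => a
  | a, b :: bs => rightAct (wordActLetter r a b).2 bs

variable (k : Type u) [Field k] [LinearOrder X]

/-- The set `N_d` of normal words of length `d` of the algebra `A(k, X, r)`. -/
def normalWordsOfLength (d : ℕ) : Set (List X) :=
  {w | w ∈ normalWords k (relationIdeal k r) ∧ w.length = d}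

/-- For words `a, b` of `N_d`, the equality `ρ_d(a, b) = (a', b')` of pairs of words of `N_d`,
where `ρ_d(a, b) = (Nor(ᵃb), Nor(aᵇ))`. -/
def NormalizedSolution (d : ℕ) (a b a' b' : List X) : Prop :=
  a' ∈ normalWordsOfLength r k d ∧ b' ∈ normalWordsOfLength r k d ∧
  IsNormalForm k (relationIdeal k r) (word k (leftAct r a b)) (word k a') ∧
  IsNormalForm k (relationIdeal k r) (word k (rightAct r a b)) (word k b')

/-- The word `x₁^{d-1} x`, where `x₁` is the first letter of the alphabet. -/
def veroneseWord [OrderBot X] (d : ℕ) (x : X) : List X :=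
  List.replicate (d - 1) ⊥ ++ [x]

/-- `s = r^{(d)}`: the map `s` is the `d`-th term of the Veronese prolongation of `(X, r)`. This
says that `x ↦ x₁^{d-1} x` is an identification of `X` with `N_d`, under which `s` corresponds to
the solution `ρ_d` on `N_d`. -/
def IsVeroneseProlongation [OrderBot X] (d : ℕ) (s : X × X → X × X) : Prop :=
  Set.BijOn (veroneseWord d) (Set.univ : Set X) (normalWordsOfLength r k d) ∧
  ∀ x y : X, NormalizedSolution r k d (veroneseWord d x) (veroneseWord d y)
    (veroneseWord d (s (x, y)).1) (veroneseWord d (s (x, y)).2)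

end Prolongation

/-- The permutation idempotent solution `r_f (x, y) = (f y, y)`. -/
def permSolution {X : Type v} (f : Equiv.Perm X) : X × X → X × X :=
  fun p => (f p.2, p.2)

end YangBaxterAlgebra

open YangBaxterAlgebra

/-! In `A(k, X, r_f)` both `xy` and `zy` equal `f(y)y`, so any letter followed by another letter may
be replaced freely. Hence two words agree exactly when they have the same length and the same last
letter, and the algebra is the monoid algebra of a monoid in which `f` no longer appears
(`classAlgebraEquiv`).

The least word of a class is `x₁ⁿx`, so these and the empty word are the normal words
(`replicate_append_mem_normalWords`, `eq_replicate_of_mem_normalWords`). A normal form of a nonempty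
word is thus read off from its length and last letter. A word of length `d` acts on the left by
applying `f^d` to each letter, while `aᵇ` ends in the last letter of `b`; this gives `r_{f^d}`.

Substituting `x₁^{d-1}x` for `x` multiplies lengths by `d` and keeps last letters. It is therefore
injective on classes and maps the classes of length `m` onto those of length `md`, which yields the
Veronese isomorphism. -/

namespace YangBaxterAlgebra

universe u v

/-! ### The monoid of words modulo "same length and same last letter" -/

section LastLetter

variable (X : Type v)

/-- The congruence on words identifying two words of the same length with the same last letter. -/
def lastLetterCon : Con (FreeMonoid X) where
  r u v := u.toList.length = v.toList.length ∧ u.toList.getLast? = v.toList.getLast?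
  iseqv := ⟨fun _ => ⟨rfl, rfl⟩, fun h => ⟨h.1.symm, h.2.symm⟩,
    fun h h' => ⟨h.1.trans h'.1, h.2.trans h'.2⟩⟩
  mul' h h' := by
    simp only [FreeMonoid.toList_mul, List.length_append, List.getLast?_append]
    exact ⟨by rw [h.1, h'.1], by rw [h.2, h'.2]⟩

variable {X}

/-- The class of a word. -/
def lastLetterClass (w : List X) : (lastLetterCon X).Quotient :=
  (lastLetterCon X).mk' (FreeMonoid.ofList w)

theorem lastLetterClass_eq_iff {u w : List X} :
    lastLetterClass u = lastLetterClass w ↔ u.length = w.length ∧ u.getLast? = w.getLast? :=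
  (lastLetterCon X).eq

theorem lastLetterClass_append (u w : List X) :
    lastLetterClass (u ++ w) = lastLetterClass u * lastLetterClass w := rfl

theorem lastLetterClass_surjective : Function.Surjective (lastLetterClass (X := X)) :=
  fun m => Con.induction_on m fun w => ⟨w.toList, rfl⟩

variable (k : Type u) [Field k]

theorem word_append (u w : List X) : word k (u ++ w) = word k u * word k w := by
  simp [word]

theorem word_cons (x : X) (w : List X) : word k (x :: w) = FreeAlgebra.ι k x * word k w := by
  simp [word]

theorem basisFreeMonoid_apply (w : FreeMonoid X) :
    FreeAlgebra.basisFreeMonoid k X w = word k w.toList := by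
  simp [FreeAlgebra.basisFreeMonoid, FreeAlgebra.equivMonoidAlgebraFreeMonoid, word,
    FreeMonoid.lift_apply]

theorem coeff_word [DecidableEq X] (u w : List X) :
    coeff k (word k u) w = if u = w then 1 else 0 := by
  have h : word k u = FreeAlgebra.basisFreeMonoid k X (FreeMonoid.ofList u) := by
    rw [basisFreeMonoid_apply, FreeMonoid.toList_ofList]
  rw [coeff, h, Module.Basis.repr_self]
  split_ifs with huw
  · rw [huw, Finsupp.single_eq_same]
  · exact Finsupp.single_eq_of_ne' huw

/-- The evaluation of noncommutative polynomials in the monoid algebra of classes of words. -/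
noncomputable def toClassAlgebra :
    FreeAlgebra k X →ₐ[k] MonoidAlgebra k (lastLetterCon X).Quotient :=
  FreeAlgebra.lift k fun x => MonoidAlgebra.of k _ (lastLetterClass [x])

theorem toClassAlgebra_word (w : List X) :
    toClassAlgebra k (word k w) = MonoidAlgebra.of k _ (lastLetterClass w) := by
  induction w with
  | nil => exact (map_one _).trans (map_one _).symm
  | cons x w ih =>
    rw [word_cons, map_mul, ih, toClassAlgebra, FreeAlgebra.lift_ι_apply, ← map_mul,
      ← lastLetterClass_append]
    rfl

/-- A coefficient of the image is the sum of the coefficients of `p` over a class; here `u` is the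
only word of its class that can contribute. -/
theorem coeff_toClassAlgebra (p : FreeAlgebra k X) (u : List X)
    (h : ∀ w, coeff k p w ≠ 0 → w ≠ u → lastLetterClass w ≠ lastLetterClass u) :
    (toClassAlgebra k p).coeff (lastLetterClass u) = coeff k p u := by
  classical
  conv_lhs => rw [← (FreeAlgebra.basisFreeMonoid k X).linearCombination_repr p]
  rw [Finsupp.linearCombination_apply, Finsupp.sum, map_sum]
  simp only [map_smul, basisFreeMonoid_apply, toClassAlgebra_word, MonoidAlgebra.coeff_sum,
    Finsupp.finsetSum_apply, MonoidAlgebra.coeff_smul, Finsupp.smul_apply, smul_eq_mul,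
    MonoidAlgebra.of_apply, MonoidAlgebra.coeff_single]
  rw [Finset.sum_eq_single (FreeMonoid.ofList u)]
  · simp [coeff]
  · intro w hw hne
    rw [Finsupp.single_eq_of_ne, mul_zero]
    exact (h w.toList (Finsupp.mem_support_iff.1 hw) hne).symm
  · intro hu
    rw [Finsupp.notMem_support_iff.1 hu, zero_mul]

end LastLetter

/-! ### The algebra of a permutation idempotent solution -/

section Permutation

variable (k : Type u) [Field k] {X : Type v} (f : Equiv.Perm X)

theorem toClassAlgebra_eq_zero_of_mem {p : FreeAlgebra k X}
    (hp : p ∈ relationIdeal k (permSolution f)) : toClassAlgebra k p = 0 := by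
  have h : relationIdeal k (permSolution f) ≤
      TwoSidedIdeal.ker (toClassAlgebra (X := X) k).toRingHom := by
    refine TwoSidedIdeal.span_le.2 ?_
    rintro _ ⟨x, y, -, rfl⟩
    refine (TwoSidedIdeal.mem_ker _).2 ?_
    change toClassAlgebra k _ = 0
    rw [map_sub, toClassAlgebra_word, toClassAlgebra_word, sub_eq_zero]
    exact congrArg _ (lastLetterClass_eq_iff.2 ⟨rfl, rfl⟩)
  exact (TwoSidedIdeal.mem_ker _).1 (h hp)

theorem mkYB_eq_mkYB_iff {r : X × X → X × X} {p q : FreeAlgebra k X} :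
    mkYB k r p = mkYB k r q ↔ p - q ∈ relationIdeal k r :=
  (RingCon.eq _).trans (TwoSidedIdeal.rel_iff _ _ _)

theorem mkYB_word_pair (x z y : X) :
    mkYB k (permSolution f) (word k [x, y]) = mkYB k (permSolution f) (word k [z, y]) := by
  have h (x : X) : mkYB k (permSolution f) (word k [x, y]) =
      mkYB k (permSolution f) (word k [f y, y]) := by
    -- A fixed pair gives no relation, but then `x` is already `f y`.
    by_cases hx : permSolution f (x, y) = (x, y)
    · rw [show f y = x from congrArg Prod.fst hx]
    · exact (mkYB_eq_mkYB_iff k).2 (TwoSidedIdeal.subset_span ⟨x, y, hx, rfl⟩)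
  exact (h x).trans (h z).symm

theorem mkYB_word_cons (x z y : X) (w : List X) :
    mkYB k (permSolution f) (word k (x :: y :: w)) =
      mkYB k (permSolution f) (word k (z :: y :: w)) := by
  have h (x : X) : word k (x :: y :: w) = word k [x, y] * word k w := by
    rw [← word_append]; rfl
  rw [h, h, map_mul, map_mul, mkYB_word_pair k f x z y]

theorem mkYB_word_eq_replicate (z y : X) (u : List X) :
    mkYB k (permSolution f) (word k (u ++ [y])) =
      mkYB k (permSolution f) (word k (List.replicate u.length z ++ [y])) := by
  induction u with
  | nil => rfl
  | cons x u ih =>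
    rw [List.cons_append, word_cons, map_mul, ih, ← map_mul, ← word_cons, List.length_cons,
      List.replicate_succ, List.cons_append]
    -- The replaced letter `x` is followed by `y` if `u` is empty, and by `z` otherwise.
    cases u with
    | nil => exact mkYB_word_cons k f x z y []
    | cons => exact mkYB_word_cons k f x z z _

theorem mkYB_word_eq_of_class_eq {u w : List X} (h : lastLetterClass u = lastLetterClass w) :
    mkYB k (permSolution f) (word k u) = mkYB k (permSolution f) (word k w) := by
  obtain ⟨hl, hg⟩ := lastLetterClass_eq_iff.1 h
  rcases List.eq_nil_or_concat u with rfl | ⟨u, x, rfl⟩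
  · rw [List.length_eq_zero_iff.1 hl.symm]
  rcases List.eq_nil_or_concat w with rfl | ⟨w, y, rfl⟩
  · simp at hl
  simp only [List.concat_eq_append, List.length_append, List.length_singleton,
    Nat.add_right_cancel_iff, List.getLast?_append, List.getLast?_singleton,
    Option.some_or, Option.some.injEq] at hl hg ⊢
  rw [mkYB_word_eq_replicate k f x x u, mkYB_word_eq_replicate k f x y w, hl, hg]

/-- The algebra `A(k, X, r_f)` is the monoid algebra of the monoid of words modulo
"same length and same last letter". -/
noncomputable def classAlgebraEquiv :
    YBAlgebra k (permSolution f) ≃ₐ[k] MonoidAlgebra k (lastLetterCon X).Quotient :=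
  AlgEquiv.ofAlgHom
    (RingCon.liftₐ _ (toClassAlgebra k) (fun p q h => by
      have h' := toClassAlgebra_eq_zero_of_mem k f ((TwoSidedIdeal.rel_iff _ _ _).1 h)
      rwa [map_sub, sub_eq_zero] at h'))
    (MonoidAlgebra.lift k _ _ ((lastLetterCon X).lift
      (FreeMonoid.lift fun x => mkYB k (permSolution f) (FreeAlgebra.ι k x)) (fun u w h => by
        have h' (w : FreeMonoid X) : FreeMonoid.lift
            (fun x => mkYB k (permSolution f) (FreeAlgebra.ι k x)) w =
            mkYB k (permSolution f) (word k w.toList) := by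
          simp only [FreeMonoid.lift_apply, word, map_list_prod, List.map_map]
          rfl
        refine ((h' u).trans (mkYB_word_eq_of_class_eq k f ?_)).trans (h' w).symm
        exact lastLetterClass_eq_iff.2 h)))
    (by
      refine MonoidAlgebra.algHom_ext' ?_ (by ext)
      refine Con.hom_ext ?_
      refine FreeMonoid.hom_eq fun x => ?_
      simp only [MonoidHom.comp_apply, Con.coe_mk', MonoidHom.coe_coe, AlgHom.comp_apply,
        MonoidAlgebra.of_apply, MonoidAlgebra.lift_single, one_smul,
        AlgHom.id_apply]
      exact FreeAlgebra.lift_ι_apply _ _)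
    (by
      ext x
      change MonoidAlgebra.lift k _ _ _ (toClassAlgebra k (FreeAlgebra.ι k x)) =
        mkYB k (permSolution f) (FreeAlgebra.ι k x)
      rw [toClassAlgebra, FreeAlgebra.lift_ι_apply, MonoidAlgebra.lift_of]
      exact FreeMonoid.lift_eval_of _ _)

theorem classAlgebraEquiv_word (w : List X) :
    classAlgebraEquiv k f (mkYB k (permSolution f) (word k w)) =
      MonoidAlgebra.of k _ (lastLetterClass w) :=
  toClassAlgebra_word k w

end Permutation
/-! ### Normal words -/

section NormalWords

/-- The letter `y` sits at or before the final `x`, so `u` lies inside the block of `z`'s. -/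
theorem eq_replicate_of_append_singleton_infix {X : Type v} {u : List X} {x y z : X} {n : ℕ}
    (h : u ++ [y] <:+: List.replicate n z ++ [x]) : u = List.replicate u.length z := by
  obtain ⟨s, t, h⟩ := h
  refine List.eq_replicate_iff.2 ⟨rfl, fun a ha => ?_⟩
  have hmem : a ∈ List.replicate n z := by
    rcases List.eq_nil_or_concat t with rfl | ⟨t, b, rfl⟩
    · rw [List.append_nil, ← List.append_assoc] at h
      rw [← (List.append_inj' h rfl).1]
      exact List.mem_append_right _ ha
    · rw [List.concat_eq_append, ← List.append_assoc] at h
      rw [← (List.append_inj' h rfl).1]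
      simp [ha]
  exact List.eq_of_mem_replicate hmem

variable (k : Type u) [Field k] {X : Type v} [LinearOrder X]

theorem isLeadingMonomial_pair {x z : X} (h : z < x) (y : X) :
    IsLeadingMonomial k (word k [x, y] - word k [z, y]) [x, y] := by
  have hsub (w : List X) : coeff k (word k [x, y] - word k [z, y]) w =
      (if [x, y] = w then 1 else 0) - (if [z, y] = w then 1 else 0) := by
    rw [← coeff_word, ← coeff_word, coeff, map_sub, Finsupp.sub_apply]
    rfl
  refine ⟨?_, fun u hu hne => ?_⟩
  · simp [hsub, h.ne]
  · have hz : [z, y] = u := by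
      by_contra hzu
      exact hu (by rw [hsub, if_neg hne.symm, if_neg hzu, sub_zero])
    rw [← hz]
    exact List.Shortlex.of_lex rfl (List.Lex.rel h)

variable [OrderBot X] (f : Equiv.Perm X)

theorem not_lex_replicate_bot (y : X) (w : List X) :
    ¬ List.Lex (· < ·) (w ++ [y]) (List.replicate w.length ⊥ ++ [y]) := by
  induction w with
  | nil =>
    intro h
    cases h with
    | rel h => exact lt_irrefl _ h
    | cons h => cases h
  | cons a w ih =>
    intro h
    rw [List.length_cons, List.replicate_succ, List.cons_append, List.cons_append] at h
    cases h with
    | rel h => exact not_lt_bot h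
    | cons h => exact ih h

/-- A leading monomial `u` inside this word is itself least in its class, whereas the other words of
`p` are smaller than `u`, hence outside that class. So the coefficient of `u` survives in the class
algebra, where `p` vanishes. -/
theorem replicate_append_mem_normalWords (n : ℕ) (x : X) :
    List.replicate n ⊥ ++ [x] ∈ normalWords k (relationIdeal k (permSolution f)) := by
  intro p hp u hu hinf
  refine hu.1 ?_
  rw [← coeff_toClassAlgebra, toClassAlgebra_eq_zero_of_mem k f hp]
  · rfl
  intro w hw hne hcl
  have hlt := hu.2 w hw hne
  obtain ⟨hl, hg⟩ := lastLetterClass_eq_iff.1 hcl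
  rw [List.shortlex_iff_lex hl] at hlt
  rcases List.eq_nil_or_concat u with rfl | ⟨u, y, rfl⟩
  · exact hne (List.length_eq_zero_iff.1 hl)
  rcases List.eq_nil_or_concat w with rfl | ⟨w, y', rfl⟩
  · simp at hl
  simp only [List.concat_eq_append, List.length_append, List.length_singleton,
    Nat.add_right_cancel_iff, List.getLast?_append, List.getLast?_singleton,
    Option.some_or, Option.some.injEq] at hl hg hlt hinf
  rw [eq_replicate_of_append_singleton_infix hinf, ← hl, hg] at hlt
  exact not_lex_replicate_bot y w hlt

/-- The obstruction is `xy - x₁y`, which lies in the ideal though it need not be a defining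
relation. -/
theorem not_pair_infix_of_mem_normalWords {x : X} (hx : x ≠ ⊥) (y : X) {w : List X}
    (hw : w ∈ normalWords k (relationIdeal k (permSolution f))) : ¬ [x, y] <:+: w :=
  hw _ ((mkYB_eq_mkYB_iff k).1 (mkYB_word_pair k f x ⊥ y)) _
    (isLeadingMonomial_pair k (bot_lt_iff_ne_bot.2 hx) y)

theorem eq_replicate_of_mem_normalWords {u : List X} {x : X}
    (hw : u ++ [x] ∈ normalWords k (relationIdeal k (permSolution f))) :
    u = List.replicate u.length ⊥ := by
  refine List.eq_replicate_iff.2 ⟨rfl, fun a ha => by_contra fun hne => ?_⟩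
  obtain ⟨s, t, rfl⟩ := List.append_of_mem ha
  cases t with
  | nil => exact not_pair_infix_of_mem_normalWords k f hne x hw ⟨s, [], by simp⟩
  | cons b t => exact not_pair_infix_of_mem_normalWords k f hne b hw ⟨s, t ++ [x], by simp⟩

theorem length_veroneseWord {d : ℕ} (hd : 1 ≤ d) (x : X) : (veroneseWord d x).length = d := by
  simp [veroneseWord, Nat.sub_add_cancel hd]

theorem getLast?_veroneseWord (d : ℕ) (x : X) : (veroneseWord d x).getLast? = some x := by
  simp [veroneseWord]

theorem veroneseWord_mem_normalWordsOfLength {d : ℕ} (hd : 1 ≤ d) (x : X) :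
    veroneseWord d x ∈ normalWordsOfLength (permSolution f) k d :=
  ⟨replicate_append_mem_normalWords k f _ x, length_veroneseWord hd x⟩

theorem bijOn_veroneseWord {d : ℕ} (hd : 1 ≤ d) :
    Set.BijOn (veroneseWord d) (Set.univ : Set X) (normalWordsOfLength (permSolution f) k d) := by
  refine ⟨fun x _ => veroneseWord_mem_normalWordsOfLength k f hd x, fun x _ y _ h => ?_, ?_⟩
  · have h' := congrArg List.getLast? h
    rwa [getLast?_veroneseWord, getLast?_veroneseWord, Option.some.injEq] at h'
  · rintro w ⟨hw, rfl⟩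
    rcases List.eq_nil_or_concat w with rfl | ⟨u, x, rfl⟩
    · simp at hd
    rw [List.concat_eq_append] at hw ⊢
    refine ⟨x, trivial, ?_⟩
    rw [veroneseWord, List.length_append, List.length_singleton, Nat.add_sub_cancel,
      ← eq_replicate_of_mem_normalWords k f hw]

theorem isNormalForm_word_veroneseWord {d : ℕ} (hd : 1 ≤ d) {w : List X} {x : X}
    (hl : w.length = d) (hg : w.getLast? = some x) :
    IsNormalForm k (relationIdeal k (permSolution f)) (word k w) (word k (veroneseWord d x)) := by
  refine ⟨Submodule.subset_span ⟨_, replicate_append_mem_normalWords k f _ x, rfl⟩, ?_⟩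
  refine (mkYB_eq_mkYB_iff k).1 (mkYB_word_eq_of_class_eq k f (lastLetterClass_eq_iff.2 ?_))
  rw [length_veroneseWord hd, getLast?_veroneseWord]
  exact ⟨hl, hg⟩

end NormalWords

/-! ### The actions on words -/

section Actions

variable {X : Type v} (f : Equiv.Perm X)

theorem letterActWord_permSolution (c : X) (b : List X) :
    letterActWord (permSolution f) c b = b.map f := by
  induction b generalizing c with
  | nil => rfl
  | cons b bs ih => exact congrArg (f b :: ·) (ih b)

theorem leftAct_permSolution (a b : List X) :
    leftAct (permSolution f) a b = b.map ⇑(f ^ a.length) := by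
  induction a with
  | nil => simp [leftAct]
  | cons a as ih =>
    rw [leftAct, letterActWord_permSolution, ih, List.map_map, List.length_cons, pow_succ']
    rfl

theorem length_wordActLetter (r : X × X → X × X) (a : List X) (c : X) :
    (wordActLetter r a c).2.length = a.length := by
  induction a with
  | nil => rfl
  | cons a as ih => exact congrArg (· + 1) ih

/-- The letter `c` meets the last letter of `a` first, and `r_f` leaves `c` in its place. -/
theorem getLast?_wordActLetter_permSolution {a : List X} (ha : a ≠ []) (c : X) :
    (wordActLetter (permSolution f) a c).2.getLast? = some c := by
  induction a with
  | nil => exact absurd rfl ha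
  | cons a as ih =>
    cases as with
    | nil => rfl
    | cons b bs => exact List.getLast?_cons_cons.trans (ih (List.cons_ne_nil b bs))

theorem length_rightAct (r : X × X → X × X) (a b : List X) :
    (rightAct r a b).length = a.length := by
  induction b generalizing a with
  | nil => rfl
  | cons b bs ih => rw [rightAct, ih, length_wordActLetter]

/-- Each letter of `b` overwrites the last letter in turn, so the last one to act prevails. -/
theorem getLast?_rightAct_permSolution {a : List X} (ha : a ≠ []) (b : List X) :
    (rightAct (permSolution f) a b).getLast? = b.getLast?.or a.getLast? := by
  induction b generalizing a with
  | nil => rfl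
  | cons b bs ih =>
    rw [rightAct, ih, getLast?_wordActLetter_permSolution f ha, List.getLast?_cons]
    · cases bs.getLast? <;> rfl
    · rw [← List.length_pos_iff_ne_nil, length_wordActLetter]
      exact List.length_pos_iff_ne_nil.2 ha

theorem isVeroneseProlongation_permSolution (k : Type u) [Field k] [LinearOrder X] [OrderBot X]
    {d : ℕ} (hd : 1 ≤ d) :
    IsVeroneseProlongation (permSolution f) k d (permSolution (f ^ d)) := by
  refine ⟨bijOn_veroneseWord k f hd, fun x y => ⟨veroneseWord_mem_normalWordsOfLength k f hd _,
    veroneseWord_mem_normalWordsOfLength k f hd _, ?_, ?_⟩⟩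
  · refine isNormalForm_word_veroneseWord k f hd ?_ ?_
    · rw [leftAct_permSolution, List.length_map, length_veroneseWord hd]
    · rw [leftAct_permSolution, List.getLast?_map, getLast?_veroneseWord, length_veroneseWord hd]
      rfl
  · refine isNormalForm_word_veroneseWord k f hd ?_ ?_
    · rw [length_rightAct, length_veroneseWord hd]
    · rw [getLast?_rightAct_permSolution f, getLast?_veroneseWord]
      · rfl
      · simp [veroneseWord]

end Actions

/-! ### The Veronese subalgebra -/

section VeroneseIso

variable {X : Type v} [LinearOrder X] [OrderBot X] {d : ℕ}

theorem length_flatMap_veroneseWord (hd : 1 ≤ d) (w : List X) :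
    (w.flatMap (veroneseWord d)).length = w.length * d := by
  induction w with
  | nil => simp
  | cons x w ih =>
    rw [List.flatMap_cons, List.length_append, ih, length_veroneseWord hd, List.length_cons,
      add_mul, one_mul, add_comm]

theorem getLast?_flatMap_veroneseWord (d : ℕ) (w : List X) :
    (w.flatMap (veroneseWord d)).getLast? = w.getLast? := by
  rcases List.eq_nil_or_concat w with rfl | ⟨u, x, rfl⟩
  · rfl
  · simp [getLast?_veroneseWord]

theorem lastLetterClass_flatMap_eq_iff (hd : 1 ≤ d) {u w : List X} :
    lastLetterClass (u.flatMap (veroneseWord d)) = lastLetterClass (w.flatMap (veroneseWord d)) ↔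
      lastLetterClass u = lastLetterClass w := by
  rw [lastLetterClass_eq_iff, lastLetterClass_eq_iff, length_flatMap_veroneseWord hd,
    length_flatMap_veroneseWord hd, getLast?_flatMap_veroneseWord, getLast?_flatMap_veroneseWord,
    Nat.mul_left_inj (by omega)]

/-- The endomorphism `x ↦ x₁^{d-1} x` of the monoid of classes of words. -/
def veroneseMonoidHom (hd : 1 ≤ d) : (lastLetterCon X).Quotient →* (lastLetterCon X).Quotient :=
  (lastLetterCon X).lift
    { toFun := fun w => lastLetterClass (w.toList.flatMap (veroneseWord d))
      map_one' := rfl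
      map_mul' := fun u w => by
        rw [FreeMonoid.toList_mul, List.flatMap_append, lastLetterClass_append] }
    (fun _ _ h => (lastLetterClass_flatMap_eq_iff hd).2 (lastLetterClass_eq_iff.2 h))

theorem veroneseMonoidHom_lastLetterClass (hd : 1 ≤ d) (w : List X) :
    veroneseMonoidHom hd (lastLetterClass w) = lastLetterClass (w.flatMap (veroneseWord d)) :=
  rfl

theorem veroneseMonoidHom_injective (hd : 1 ≤ d) :
    Function.Injective (veroneseMonoidHom (X := X) hd) := by
  intro a b h
  obtain ⟨u, rfl⟩ := lastLetterClass_surjective a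
  obtain ⟨w, rfl⟩ := lastLetterClass_surjective b
  exact (lastLetterClass_flatMap_eq_iff hd).1 h

variable (k : Type u) [Field k] (g f : Equiv.Perm X)

/-- The Veronese homomorphism `A(k, X, r_g) → A(k, X, r_f)`, `x ↦ x₁^{d-1} x`. -/
noncomputable def veroneseHom (hd : 1 ≤ d) :
    YBAlgebra k (permSolution g) →ₐ[k] YBAlgebra k (permSolution f) :=
  ((classAlgebraEquiv k f).symm.toAlgHom.comp
    (MonoidAlgebra.mapDomainAlgHom k k (veroneseMonoidHom hd))).comp
      (classAlgebraEquiv k g).toAlgHom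

theorem veroneseHom_word (hd : 1 ≤ d) (w : List X) :
    veroneseHom k g f hd (mkYB k (permSolution g) (word k w)) =
      mkYB k (permSolution f) (word k (w.flatMap (veroneseWord d))) := by
  refine (classAlgebraEquiv k f).symm_apply_eq.2 ?_
  rw [classAlgebraEquiv_word]
  refine (congrArg (MonoidAlgebra.mapDomainAlgHom k k (veroneseMonoidHom hd))
    (classAlgebraEquiv_word k g w)).trans ?_
  simp [veroneseMonoidHom_lastLetterClass]

theorem veroneseHom_injective (hd : 1 ≤ d) : Function.Injective (veroneseHom k g f hd) :=
  ((classAlgebraEquiv k f).symm.injective.comp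
    (MonoidAlgebra.mapDomain_injective (veroneseMonoidHom_injective hd))).comp
      (classAlgebraEquiv k g).injective

theorem map_veroneseHom_component (hd : 1 ≤ d) (m : ℕ) :
    (component k (permSolution g) m).map (veroneseHom k g f hd).toLinearMap =
      component k (permSolution f) (m * d) := by
  rw [component, component, Submodule.map_span, Set.image_image]
  congr 1
  refine Set.Subset.antisymm ?_ ?_
  · rintro _ ⟨w, rfl, rfl⟩
    exact ⟨w.flatMap (veroneseWord d), length_flatMap_veroneseWord hd w,
      (veroneseHom_word k g f hd w).symm⟩
  · rintro _ ⟨w, hw, rfl⟩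
    change w.length = m * d at hw
    obtain ⟨u, hu, hg⟩ : ∃ u : List X, u.length = m ∧ u.getLast? = w.getLast? := by
      -- For `m = 0` there is no last letter; otherwise any word of length `m` with the last letter
      -- of `w` is a preimage up to class.
      rcases Nat.eq_zero_or_pos m with rfl | hm
      · rw [zero_mul] at hw
        exact ⟨w, hw, rfl⟩
      · have hne : w ≠ [] := List.length_pos_iff_ne_nil.1 (hw ▸ Nat.mul_pos hm hd)
        refine ⟨List.replicate m (w.getLast hne), List.length_replicate, ?_⟩
        rw [List.getLast?_replicate, if_neg hm.ne', List.getLast?_eq_some_getLast hne]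
    refine ⟨u, hu, (veroneseHom_word k g f hd u).trans (mkYB_word_eq_of_class_eq k f ?_)⟩
    rw [lastLetterClass_eq_iff, length_flatMap_veroneseWord hd, getLast?_flatMap_veroneseWord,
      hu, hw]
    exact ⟨rfl, hg⟩

/-- The source is the sum of its components, and the image of each is known. -/
theorem range_veroneseHom (hd : 1 ≤ d) :
    (veroneseHom k g f hd).range = veronese (component k (permSolution f)) d := by
  apply Subalgebra.toSubmodule_injective
  have h : Subalgebra.toSubmodule (veroneseHom k g f hd).range =
      Submodule.map (veroneseHom k g f hd).toLinearMap ⊤ := by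
    ext a
    simp
  rw [h, ← (DirectSum.Decomposition.isInternal
    (component k (permSolution g))).submodule_iSup_eq_top, Submodule.map_iSup]
  simp only [map_veroneseHom_component]
  rfl

/-- The isomorphism of `A(k, X, r_g)` with the `d`-Veronese subalgebra of `A(k, X, r_f)`. -/
noncomputable def veroneseEquiv (hd : 1 ≤ d) :
    YBAlgebra k (permSolution g) ≃ₐ[k] veronese (component k (permSolution f)) d :=
  (AlgEquiv.ofInjective _ (veroneseHom_injective k g f hd)).trans
    (Subalgebra.equivOfEq _ _ (range_veroneseHom k g f hd))

theorem coe_veroneseEquiv (hd : 1 ≤ d) (a : YBAlgebra k (permSolution g)) :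
    (veroneseEquiv k g f hd a : YBAlgebra k (permSolution f)) = veroneseHom k g f hd a := rfl

theorem map_veroneseEquiv_component (hd : 1 ≤ d) (m : ℕ) :
    (component k (permSolution g) m).map (veroneseEquiv k g f hd).toLinearMap =
      veroneseComponent (component k (permSolution f)) d m := by
  ext a
  have h : a ∈ veroneseComponent (component k (permSolution f)) d m ↔
      (a : YBAlgebra k (permSolution f)) ∈ component k (permSolution f) (m * d) := Iff.rfl
  rw [h, ← map_veroneseHom_component k g f hd, Submodule.mem_map, Submodule.mem_map]
  exact exists_congr fun c => and_congr_right fun _ => Subtype.ext_iff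

end VeroneseIso

end YangBaxterAlgebra

open YangBaxterAlgebra
theorem corollary6 {k : Type*} [Field k] {X : Type*} [Finite X] [LinearOrder X] [OrderBot X]
    (f : Equiv.Perm X) (d : ℕ) (hd : 2 ≤ d) :
    IsVeroneseProlongation (permSolution f) k d (permSolution (f ^ d)) ∧
    ∃ φ : YBAlgebra k (permSolution (f ^ d)) ≃ₐ[k]
        veronese (component k (permSolution f)) d,
      (∀ m : ℕ, (component k (permSolution (f ^ d)) m).map φ.toLinearMap =
        veroneseComponent (component k (permSolution f)) d m) ∧
      ∀ x : X, (φ (mkYB k (permSolution (f ^ d)) (word k [x])) : YBAlgebra k (permSolution f)) =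
        mkYB k (permSolution f) (word k (veroneseWord d x)) := by
  have hd' : 1 ≤ d := by omega
  -- The algebra isomorphism exists for every source permutation; `f ^ d` is the one matching the
  -- prolongation.
  refine ⟨isVeroneseProlongation_permSolution f k hd', veroneseEquiv k (f ^ d) f hd',
    map_veroneseEquiv_component k (f ^ d) f hd', fun x => ?_⟩
  rw [coe_veroneseEquiv, veroneseHom_word, List.flatMap_singleton]
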